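/- Let $\mathfrak g$ be a finite-dimensional complex simple Lie algebra, with a Cartan subalgebra, a set of simple roots, and a nondegenerate invariant symmetric bilinear form; Casimir operators are taken with respect to this form. Let $\beta_1=\alpha_0$ be the highest root, and for $2\le i\le k$ let $\beta_i$ be a highest (that is, maximal) element among the long roots orthogonal to $\beta_1,\dots,\beta_{i-1}$. Put $\sigma_i=\beta_1+\cdots+\beta_i$ and suppose that $\sigma_i$ is dominant for every $i\le k$, where $k\ge 1$. Let $2t$ be the Casimir eigenvalue of the adjoint representation and, if $k\ge 2$, let $\beta$ be Vogel's parameter, defined by the condition that the irreducible component $Y_2(\beta)$ of $S^2\mathfrak g$ of highest weight $\alpha_0+\beta_2$ has Casimir eigenvalue $4t-2\beta$. Let $Y_k(\beta)$ be an irreducible component of $S^k\mathfrak g$ of highest weight $\sigma_k$. Then the Casimir operator acts on $Y_k(\beta)$ as the scalar $$2kt-k(k-1)\beta .$$ (For $k=1$ the term with $\beta$ vanishes, and no parameter $\beta$ is needed.) -/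

import Mathlib

open LieAlgebra LieModule Module

noncomputable section

namespace CasimirSeries

/-! ### The symmetric powers of a Lie algebra as Lie modules -/

section SymmetricPowers

variable {L : Type*} [LieRing L] [LieAlgebra ℂ L]

/-- `p ↦ p + ε (x · p)`, as an algebra map to the dual numbers over the symmetric algebra. -/
def adDual (x : L) : SymmetricAlgebra ℂ L →ₐ[ℂ] DualNumber (SymmetricAlgebra ℂ L) :=
  SymmetricAlgebra.lift
    ((TrivSqZeroExt.inlAlgHom ℂ (SymmetricAlgebra ℂ L) (SymmetricAlgebra ℂ L)).toLinearMap ∘ₗ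
        SymmetricAlgebra.ι ℂ L +
      (TrivSqZeroExt.inrHom (SymmetricAlgebra ℂ L) (SymmetricAlgebra ℂ L)).restrictScalars ℂ ∘ₗ
        SymmetricAlgebra.ι ℂ L ∘ₗ (LieAlgebra.ad ℂ L x : L →ₗ[ℂ] L))

lemma adDual_ι (x y : L) : adDual x (SymmetricAlgebra.ι ℂ L y) =
    TrivSqZeroExt.inl (SymmetricAlgebra.ι ℂ L y) +
      TrivSqZeroExt.inr (SymmetricAlgebra.ι ℂ L ⁅x, y⁆) := by
  simp [adDual]

lemma fst_adDual (x : L) (p : SymmetricAlgebra ℂ L) : (adDual x p).fst = p := by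
  have h : (TrivSqZeroExt.fstHom ℂ (SymmetricAlgebra ℂ L) (SymmetricAlgebra ℂ L)).comp
      (adDual x) = AlgHom.id ℂ _ := by
    apply SymmetricAlgebra.algHom_ext
    ext y
    simp [adDual_ι]
  exact congr($h p)

/-- The derivation of the symmetric algebra of `L` which extends `ad x`. -/
def adDer (x : L) : Derivation ℂ (SymmetricAlgebra ℂ L) (SymmetricAlgebra ℂ L) :=
  Derivation.mk' ((TrivSqZeroExt.sndHom (SymmetricAlgebra ℂ L)
      (SymmetricAlgebra ℂ L)).restrictScalars ℂ ∘ₗ (adDual x).toLinearMap) (by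
    intro p q
    simp [fst_adDual, TrivSqZeroExt.snd_mul, mul_comm q])

@[simp] lemma adDer_ι (x y : L) :
    adDer x (SymmetricAlgebra.ι ℂ L y) = SymmetricAlgebra.ι ℂ L ⁅x, y⁆ := by
  simp [adDer, adDual_ι]

lemma derivation_ext {D E : Derivation ℂ (SymmetricAlgebra ℂ L) (SymmetricAlgebra ℂ L)}
    (h : ∀ y : L, D (SymmetricAlgebra.ι ℂ L y) = E (SymmetricAlgebra.ι ℂ L y)) : D = E := by
  ext p
  induction p using SymmetricAlgebra.induction with
  | algebraMap r => simp
  | ι y => exact h y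
  | mul a b ha hb => simp [ha, hb]
  | add a b ha hb => simp [ha, hb]

lemma adDer_add (x y : L) : adDer (x + y) = adDer x + adDer y :=
  derivation_ext fun z ↦ by simp

lemma adDer_smul (c : ℂ) (x : L) : adDer (c • x) = c • adDer x :=
  derivation_ext fun z ↦ by simp

lemma adDer_lie (x y : L) : adDer ⁅x, y⁆ = ⁅adDer x, adDer y⁆ :=
  derivation_ext fun z ↦ by simp [Derivation.commutator_apply]

/-- `L` acts on its symmetric algebra by the derivations that extend the adjoint action. -/
instance : LieRingModule L (SymmetricAlgebra ℂ L) where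
  bracket x p := adDer x p
  add_lie x y p := by simp [adDer_add]
  lie_add x p q := map_add _ _ _
  leibniz_lie x y p := by simp [adDer_lie, Derivation.commutator_apply]

lemma lie_def (x : L) (p : SymmetricAlgebra ℂ L) : ⁅x, p⁆ = adDer x p := rfl

instance : LieModule ℂ L (SymmetricAlgebra ℂ L) where
  smul_lie c x p := by simp [lie_def, adDer_smul]
  lie_smul c x p := by simp [lie_def]

variable (L) in
/-- The `k`-th symmetric power of `L`: the span of the products of `k` elements of `L` in the
symmetric algebra of `L`. -/
def symPower (k : ℕ) : LieSubmodule ℂ L (SymmetricAlgebra ℂ L) where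
  toSubmodule := LinearMap.range (SymmetricAlgebra.ι ℂ L) ^ k
  lie_mem := by
    intro x p hp
    change adDer x p ∈ LinearMap.range (SymmetricAlgebra.ι ℂ L) ^ k
    induction k generalizing p with
    | zero =>
      rw [pow_zero] at hp
      obtain ⟨r, rfl⟩ := Submodule.mem_one.1 hp
      simp
    | succ k ih =>
      replace hp : p ∈ LinearMap.range (SymmetricAlgebra.ι ℂ L) ^ (k + 1) := hp
      rw [pow_succ] at hp ⊢
      induction hp using Submodule.mul_induction_on' with
      | mem_mul_mem a ha b hb =>
        obtain ⟨y, rfl⟩ := hb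
        rw [Derivation.leibniz, smul_eq_mul, smul_eq_mul, mul_comm _ (adDer x a)]
        refine add_mem (Submodule.mul_mem_mul ha ?_) (Submodule.mul_mem_mul (ih ha) ⟨y, rfl⟩)
        rw [adDer_ι]
        exact ⟨_, rfl⟩
      | add a _ b _ iha ihb => rw [map_add]; exact add_mem iha ihb

end SymmetricPowers

/-! ### Casimir eigenvalues -/

section Casimir

variable {L : Type*} [LieRing L] [LieAlgebra ℂ L] [FiniteDimensional ℂ L]
  (Φ : LinearMap.BilinForm ℂ L) (hΦ : Φ.Nondegenerate)
  (M : Type*) [AddCommGroup M] [Module ℂ M] [LieRingModule L M] [LieModule ℂ L M]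

/-- The Casimir operator `∑ i, xᵢ xⁱ` on the module `M`, where `xᵢ` is a basis of `L`
and `xⁱ` is the dual basis with respect to the form `Φ`. -/
def casimir : M →ₗ[ℂ] M :=
  ∑ i, toEnd ℂ L M (finBasis ℂ L i) ∘ₗ toEnd ℂ L M (Φ.dualBasis hΦ (finBasis ℂ L) i)

/-- The Casimir operator acts on `M` as the scalar `c`. -/
def HasCasimirEigenvalue (c : ℂ) : Prop := ∀ m : M, casimir Φ hΦ M m = c • m

end Casimir

/-! ### Roots -/

section Roots

variable {ι R M N : Type*} [Finite ι] [CommRing R] [CharZero R] [IsDomain R]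
  [AddCommGroup M] [Module R M] [AddCommGroup N] [Module R N]
  {P : RootPairing ι R M N} [P.IsCrystallographic]

/-- The partial order on roots: `i ≤ j` if `j - i` is a sum of simple roots. -/
def RootLE (b : P.Base) (i j : ι) : Prop :=
  P.root j - P.root i ∈ AddSubmonoid.closure (P.root '' b.support)

variable (P) in
/-- A root is long if no root is longer. -/
def IsLong (i : ι) : Prop :=
  letI := Fintype.ofFinite ι
  ∀ j, (P.posRootForm ℤ).rootLength j ≤ (P.posRootForm ℤ).rootLength i

/-- `β 0` is the highest root, and each further `β m` is a highest (that is, maximal) element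
among the long roots which are orthogonal to all the previous ones. -/
structure IsHighestOrthogonalSequence (b : P.Base) {k : ℕ} (β : Fin k → ι) : Prop where
  first : ∀ m : Fin k, m.val = 0 → ∀ j, RootLE b j (β m)
  long : ∀ m, IsLong P (β m)
  orthogonal : ∀ m m', m' < m → P.IsOrthogonal (β m) (β m')
  highest : ∀ m j, IsLong P j → (∀ m' < m, P.IsOrthogonal j (β m')) → RootLE b (β m) j → j = β m

/-- The sum `β 0 + ⋯ + β m`. -/
def partialSum {k : ℕ} (β : Fin k → ι) (m : Fin k) : M := ∑ m' ∈ Finset.Iic m, P.root (β m')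

/-- A weight is dominant if it takes values in the natural numbers on the simple coroots. -/
def IsDominant (b : P.Base) (μ : M) : Prop :=
  ∀ i ∈ b.support, ∃ n : ℕ, P.toLinearMap μ (P.coroot i) = n

end Roots

/-! ### Highest weights and Vogel's parameter -/

section HighestWeight

variable {L : Type*} [LieRing L] [LieAlgebra ℂ L] [FiniteDimensional ℂ L] [IsSimple ℂ L]
  {H : LieSubalgebra ℂ L} [H.IsCartanSubalgebra] (b : (IsKilling.rootSystem H).Base)

/-- The module `M` contains a highest weight vector of weight `μ`, relative to the positive roots
given by the base `b`. -/
def HasHighestWeightVector (M : Type*) [AddCommGroup M] [Module ℂ M] [LieRingModule L M]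
    (μ : Dual ℂ H) : Prop :=
  ∃ v : M, v ≠ 0 ∧ (∀ h : H, ⁅(h : L), v⁆ = μ h • v) ∧
    ∀ α : H.root, b.IsPos α → ∀ x ∈ rootSpace H α.1, ⁅x, v⁆ = 0

/-- `Y` is an irreducible component of the `k`-th symmetric power of `L`, of highest
weight `μ`. -/
structure IsComponent (k : ℕ) (μ : Dual ℂ H) (Y : LieSubmodule ℂ L (SymmetricAlgebra ℂ L)) :
    Prop where
  le : Y ≤ symPower L k
  irreducible : LieModule.IsIrreducible ℂ L Y
  highestWeight : HasHighestWeightVector b Y μ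

/-- Vogel's parameter attached to the component `Y₂` of highest weight `α₀ + α'` of the symmetric
square of `L`, where `α₀` is the highest root, `α'` is a highest long root orthogonal to `α₀`, and
`2 t` is the Casimir eigenvalue of `L`: the Casimir eigenvalue of `Y₂` is `4 t - 2 β`. -/
def IsVogelParameter (Φ : LinearMap.BilinForm ℂ L) (hΦ : Φ.Nondegenerate) (t β : ℂ)
    (α₀ α' : H.root) : Prop :=
  ∃ Y₂ : LieSubmodule ℂ L (SymmetricAlgebra ℂ L),
    IsComponent b 2 ((IsKilling.rootSystem H).root α₀ + (IsKilling.rootSystem H).root α') Y₂ ∧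
      HasCasimirEigenvalue Φ hΦ Y₂ (4 * t - 2 * β)

end HighestWeight

end CasimirSeries

end

/-!
On an irreducible module of highest weight `μ` the Casimir operator is the scalar `(μ, μ + 2ρ)`.
The roots `βᵢ` are pairwise orthogonal and have the same length `Q`, so for `μ = β₁ + ⋯ + βₖ` this
scalar is the sum over `i` of `Q + (βᵢ, 2ρ)`, and everything reduces to `2ρ(βᵢ^∨)` being an
arithmetic progression in `i`.

Dominance of the partial sums forces, for every positive root `a`, the first nonzero number
`a(βᵢ^∨)` to be positive. The reflection in `βᵢ` permutes the positive roots whose first nonzero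
pairing occurs before `i` and changes the sign of their pairing with `βᵢ^∨`. Only the roots
orthogonal to all earlier `βₗ` therefore contribute to `2ρ(βᵢ^∨)`. Since `∑ₗ |a(βₗ^∨)| ≤ 2` for
every root `a`, their contribution is half of
`∑ₐ |a(βᵢ^∨)| - ∑_{l < i} ∑ₐ |a(βₗ^∨)| |a(βᵢ^∨)|`.
The sums over all roots are invariant under the Weyl group, and any `βᵢ` is carried to any `βⱼ` by
reflections that fix the other members of the sequence. Hence the first sum does not depend on `i`
and the inner sums do not depend on `i` and `l`. The two constants of the resulting progression are
read off the adjoint representation and `Y₂`.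
-/

noncomputable section

namespace CasimirSeries

section LongRoots

variable {ι R M N : Type*} [CommRing R]
  [AddCommGroup M] [Module R M] [AddCommGroup N] [Module R N]
  {P : RootPairing ι R M N} [P.IsCrystallographic]

lemma reflectionPerm_eq_self_of_pairingIn_eq_zero {i j : ι} (h : P.pairingIn ℤ j i = 0) :
    P.reflectionPerm i j = j := by
  apply P.root.injective
  rw [P.root_reflectionPerm, P.reflection_apply_root, ← P.algebraMap_pairingIn ℤ, h, map_zero,
    zero_smul, sub_zero]

lemma reflectionPerm_reflectionPerm_of_pairingIn_eq_one {i j : ι} (hij : P.pairingIn ℤ i j = 1)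
    (hji : P.pairingIn ℤ j i = 1) : P.reflectionPerm (P.reflectionPerm i j) i = j := by
  have hij' : P.pairing i j = 1 := by rw [← P.algebraMap_pairingIn ℤ, hij, map_one]
  have hji' : P.pairing j i = 1 := by rw [← P.algebraMap_pairingIn ℤ, hji, map_one]
  apply P.root.injective
  simp [P.root_reflectionPerm, P.reflection_reflectionPerm, P.reflection_apply_root, hij', hji',
    two_smul]

variable (P) in
/-- The sum of the absolute values of the pairings of all roots with the coroot of `i`. Together
with `absPairingProdSum`, it gives Weyl-invariant expressions for heights of coroots. -/
def absPairingSum [Fintype ι] (i : ι) : ℤ := ∑ a, |P.pairingIn ℤ a i|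

variable (P) in
/-- The sum over all roots of the products of the absolute values of the pairings with the coroots
of `i` and `j`: the correlation of `i` and `j` entering the heights of their coroots. -/
def absPairingProdSum [Fintype ι] (i j : ι) : ℤ :=
  ∑ a, |P.pairingIn ℤ a i| * |P.pairingIn ℤ a j|

lemma absPairingProdSum_comm [Fintype ι] (i j : ι) :
    absPairingProdSum P i j = absPairingProdSum P j i := by
  simp only [absPairingProdSum, mul_comm]

variable [CharZero R]

lemma absPairingSum_reflectionPerm [Fintype ι] (c i : ι) :
    absPairingSum P (P.reflectionPerm c i) = absPairingSum P i := by
  simp only [absPairingSum, P.pairingIn_reflectionPerm]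
  exact (P.reflectionPerm c).sum_comp fun a ↦ |P.pairingIn ℤ a i|

lemma absPairingProdSum_reflectionPerm [Fintype ι] (c i j : ι) :
    absPairingProdSum P (P.reflectionPerm c i) (P.reflectionPerm c j) =
      absPairingProdSum P i j := by
  simp only [absPairingProdSum, P.pairingIn_reflectionPerm]
  exact (P.reflectionPerm c).sum_comp fun a ↦ |P.pairingIn ℤ a i| * |P.pairingIn ℤ a j|

lemma pairingIn_reflectionPerm_left (i j k : ι) :
    P.pairingIn ℤ (P.reflectionPerm i j) k =
      P.pairingIn ℤ j k - P.pairingIn ℤ j i * P.pairingIn ℤ i k := by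
  apply Int.cast_injective (α := R)
  have h (x y : ι) : ((P.pairingIn ℤ x y : ℤ) : R) = P.pairing x y := P.algebraMap_pairingIn ℤ x y
  push_cast
  simp only [h, ← P.root_coroot_eq_pairing, P.root_reflectionPerm, P.reflection_apply_root,
    map_sub, map_smul, LinearMap.sub_apply, LinearMap.smul_apply, smul_eq_mul]

lemma exists_pairingIn_eq_units_mul {κ : Type*} [Finite κ] {β : κ → ι}
    (hβ : Pairwise fun p q ↦ P.pairingIn ℤ (β p) (β q) = 0) (ε : κ → ℤˣ) (a : ι) :
    ∃ a', ∀ q, P.pairingIn ℤ a' (β q) = ε q * P.pairingIn ℤ a (β q) := by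
  classical
  cases nonempty_fintype κ
  suffices ∀ s : Finset κ, ∃ a', ∀ q, P.pairingIn ℤ a' (β q) =
      (if q ∈ s then ε q else 1 : ℤˣ) * P.pairingIn ℤ a (β q) by simpa using this Finset.univ
  intro s
  induction s using Finset.induction_on with
  | empty => exact ⟨a, by simp⟩
  | insert p s hp ih =>
    obtain ⟨a', ha'⟩ := ih
    have hother (q : κ) (hq : q ≠ p) : (if q ∈ insert p s then ε q else 1 : ℤˣ) =
        if q ∈ s then ε q else 1 := by simp [hq]
    rcases Int.units_eq_one_or (ε p) with h | h
    · refine ⟨a', fun q ↦ ?_⟩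
      rcases eq_or_ne q p with rfl | hq
      · simp [ha', hp, h]
      · rw [ha', hother q hq]
    · refine ⟨P.reflectionPerm (β p) a', fun q ↦ ?_⟩
      rw [pairingIn_reflectionPerm_left, ha', ha']
      rcases eq_or_ne q p with rfl | hq
      · simp [hp, h]
        ring
      · rw [hother q hq, hβ hq.symm, mul_zero, sub_zero]

lemma exists_pairingIn_ne_zero [P.IsIrreducible] (i j : ι) :
    ∃ a, P.pairingIn ℤ a i ≠ 0 ∧ P.pairingIn ℤ a j ≠ 0 := by
  by_contra! hcon
  let s : Set ι := {a | P.pairingIn ℤ a i ≠ 0}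
  have hinvt (d : ι) :
      Submodule.span R (P.root '' s) ∈ Module.End.invtSubmodule (P.reflection d) := by
    rw [Module.End.mem_invtSubmodule, Submodule.span_le]
    rintro _ ⟨a, ha, rfl⟩
    change P.reflection d (P.root a) ∈ Submodule.span R (P.root '' s)
    by_cases hd : P.pairingIn ℤ d i = 0
    · rw [← P.root_reflectionPerm]
      refine Submodule.subset_span ⟨_, ?_, rfl⟩
      simpa [s, pairingIn_reflectionPerm_left, hd] using ha
    · rw [P.reflection_apply_root]
      exact sub_mem (Submodule.subset_span ⟨a, ha, rfl⟩)
        (Submodule.smul_mem _ _ (Submodule.subset_span ⟨d, hd, rfl⟩))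
  have htop : Submodule.span R (P.root '' s) = ⊤ := by
    refine RootPairing.IsIrreducible.eq_top_of_invtSubmodule_reflection _ hinvt ?_
    exact (Submodule.ne_bot_iff _).2 ⟨P.root i, Submodule.subset_span ⟨i, by simp [s], rfl⟩,
      P.ne_zero i⟩
  have hle : Submodule.span R (P.root '' s) ≤ LinearMap.ker (P.coroot' j) := by
    rw [Submodule.span_le]
    rintro _ ⟨a, ha, rfl⟩
    simp [← P.algebraMap_pairingIn ℤ, hcon a ha]
  have hj : P.root j ∈ LinearMap.ker (P.coroot' j) := hle (htop ▸ Submodule.mem_top)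
  simp at hj

omit [P.IsCrystallographic] in
lemma sum_eq_two_nsmul_sum_isPos [Fintype ι] {A : Type*} [AddCommMonoid A] (b : P.Base)
    [DecidablePred b.IsPos] {f : ι → A} (hf : ∀ a, f (P.reflectionPerm a a) = f a) :
    ∑ a, f a = 2 • ∑ a with b.IsPos a, f a := by
  let _ := P.indexNeg
  rw [two_nsmul, ← Finset.sum_filter_add_sum_filter_not _ b.IsPos]
  congr 1
  refine Finset.sum_nbij' (- ·) (- ·) ?_ ?_ (fun a _ ↦ neg_neg a) (fun a _ ↦ neg_neg a)
    fun a _ ↦ (hf a).symm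
  · intro a ha
    have : b.IsPos (-a) := (RootPairing.Base.IsPos.neg_iff_not b a).2 (by simpa using ha)
    simpa using this
  · intro a ha
    have : ¬ b.IsPos (-a) := mt (RootPairing.Base.IsPos.neg_iff_not b a).1 (by simpa using ha)
    simpa using this

lemma isLong_iff [Fintype ι] {i : ι} : IsLong P i ↔
    ∀ j, (P.posRootForm ℤ).rootLength j ≤ (P.posRootForm ℤ).rootLength i := by
  rw [IsLong, Subsingleton.elim (Fintype.ofFinite ι) ‹Fintype ι›]

lemma IsLong.rootLength_eq [Fintype ι] {i j : ι} (hi : IsLong P i) (hj : IsLong P j) :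
    (P.posRootForm ℤ).rootLength i = (P.posRootForm ℤ).rootLength j :=
  le_antisymm (isLong_iff.1 hj i) (isLong_iff.1 hi j)

variable [IsDomain R]

lemma pairingIn_eq_zero_comm {i j : ι} (h : P.pairingIn ℤ i j = 0) : P.pairingIn ℤ j i = 0 := by
  have : Module.IsReflexive R M := .of_isPerfPair P.toLinearMap
  exact P.pairingIn_eq_zero_iff.1 h

variable [Finite ι] [P.IsReduced] {i j : ι}

lemma IsLong.pairingIn_le_one (hi : IsLong P i) (hij : j ≠ i) :
    P.pairingIn ℤ j i ≤ 1 := by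
  cases nonempty_fintype ι
  have hpos := (P.posRootForm ℤ).rootLength_pos i
  have hle := isLong_iff.1 hi j
  have hswap := (P.posRootForm ℤ).pairingIn_mul_eq_pairingIn_mul_swap i j
  have hmem := P.pairingIn_pairingIn_mem_set_of_isCrystal_of_isRed j i
  simp only [Set.mem_insert_iff, Set.mem_singleton_iff, Prod.mk.injEq] at hmem
  by_contra! h
  have htwo : P.pairingIn ℤ j i = 2 ∧ P.pairingIn ℤ i j = 2 := by
    rcases hmem with h | h | h | h | h | h | h | h | h | h | h | h | h <;>
      first
      | exact h
      | (rw [h.1, h.2] at hswap; lia)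
  have : Module.IsReflexive R M := .of_isPerfPair P.toLinearMap
  have : Module.IsReflexive R N := .of_isPerfPair P.flip.toLinearMap
  exact hij ((P.pairingIn_two_two_iff ℤ j i).1 htwo)

lemma IsLong.neg_one_le_pairingIn (hi : IsLong P i)
    (hij : j ≠ P.reflectionPerm i i) : -1 ≤ P.pairingIn ℤ j i := by
  have hne : P.reflectionPerm j j ≠ i := by
    rintro rfl
    exact hij (P.root_eq_neg_iff.1 (by simp))
  have := hi.pairingIn_le_one hne
  rw [P.pairingIn_reflectionPerm_self_left] at this
  lia

lemma IsLong.reflectionPerm_eq_or_pairingIn_eq_one {a : ι} (hi : IsLong P i)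
    (hji : P.pairingIn ℤ j i = 0) (haj : P.pairingIn ℤ a j = 1) (hai : P.pairingIn ℤ a i = 1) :
    P.reflectionPerm a j = P.reflectionPerm i i ∨ P.pairingIn ℤ j a = 1 := by
  by_contra! h
  have hpos : 0 < P.pairingIn ℤ j a := (P.zero_lt_pairingIn_iff' ℤ).1 (haj ▸ one_pos)
  have hle := hi.neg_one_le_pairingIn h.1
  rw [pairingIn_reflectionPerm_left, hji, hai] at hle
  exact h.2 (by lia)

end LongRoots

section DominantOrthogonalSequences

variable {ι R M N : Type*} [CommRing R] [CharZero R] [IsDomain R]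
  [AddCommGroup M] [Module R M] [AddCommGroup N] [Module R N]
  {P : RootPairing ι R M N} [P.IsCrystallographic] {b : P.Base} {k : ℕ} {β : Fin k → ι}

/-- A sequence of pairwise orthogonal long roots all of whose partial sums are dominant. -/
structure IsDominantOrthogonalSequence [Finite ι] (b : P.Base) (β : Fin k → ι) : Prop where
  long : ∀ m, IsLong P (β m)
  orthogonal : Pairwise fun m m' ↦ P.pairingIn ℤ (β m) (β m') = 0
  dominant : ∀ m, IsDominant b (partialSum (P := P) β m)

lemma IsHighestOrthogonalSequence.isDominantOrthogonalSequence [Finite ι]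
    (hβ : IsHighestOrthogonalSequence b β)
    (hdom : ∀ m, IsDominant b (partialSum (P := P) β m)) :
    IsDominantOrthogonalSequence b β where
  long := hβ.long
  orthogonal := by
    have hlt {m m' : Fin k} (h : m' < m) : P.pairingIn ℤ (β m) (β m') = 0 := by
      apply Int.cast_injective (α := R)
      simpa using (P.algebraMap_pairingIn ℤ _ _).trans (hβ.orthogonal m m' h).1
    intro m m' hne
    rcases hne.lt_or_gt with h | h
    · exact pairingIn_eq_zero_comm (hlt h)
    · exact hlt h
  dominant := hdom

namespace IsDominantOrthogonalSequence

section Finite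

variable [Finite ι] (hβ : IsDominantOrthogonalSequence b β)
include hβ

omit [IsDomain R] in
lemma sum_Iic_pairingIn_nonneg_of_mem_support {a : ι} (ha : a ∈ b.support) (m : Fin k) :
    0 ≤ ∑ l ∈ Finset.Iic m, P.pairingIn ℤ a (β l) := by
  cases nonempty_fintype ι
  obtain ⟨n, hn⟩ := hβ.dominant m a ha
  have hn' : ∑ l ∈ Finset.Iic m, P.pairingIn ℤ (β l) a = n := by
    rw [partialSum, map_sum, LinearMap.sum_apply] at hn
    simp only [RootPairing.root_coroot_eq_pairing, ← P.algebraMap_pairingIn ℤ] at hn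
    apply Int.cast_injective (α := R)
    simpa using hn
  let ℓ := (P.posRootForm ℤ).rootLength
  have hswap : (∑ l ∈ Finset.Iic m, P.pairingIn ℤ a (β l)) * ℓ (β m) = n * ℓ a := by
    rw [← hn', Finset.sum_mul, Finset.sum_mul]
    refine Finset.sum_congr rfl fun l _ ↦ ?_
    simp only [ℓ, (hβ.long m).rootLength_eq (hβ.long l)]
    exact (P.posRootForm ℤ).pairingIn_mul_eq_pairingIn_mul_swap (β l) a
  refine nonneg_of_mul_nonneg_left ?_ ((P.posRootForm ℤ).rootLength_pos (β m))
  rw [hswap]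
  have := (P.posRootForm ℤ).rootLength_pos a
  positivity

lemma sum_Iic_pairingIn_nonneg {a : ι} (ha : b.IsPos a) (m : Fin k) :
    0 ≤ ∑ l ∈ Finset.Iic m, P.pairingIn ℤ a (β l) := by
  refine ha.induction_on_add (p := fun a ↦ 0 ≤ ∑ l ∈ Finset.Iic m, P.pairingIn ℤ a (β l))
    (fun a ha ↦ hβ.sum_Iic_pairingIn_nonneg_of_mem_support ha m) fun a c d hd ha hc ↦ ?_
  simp only [P.pairingIn_eq_add_of_root_eq_add hd, Finset.sum_add_distrib]
  exact add_nonneg ha (hβ.sum_Iic_pairingIn_nonneg_of_mem_support hc m)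

lemma sum_pairingIn_nonneg {a : ι} (ha : b.IsPos a) : 0 ≤ ∑ l, P.pairingIn ℤ a (β l) := by
  cases k with
  | zero => simp
  | succ k =>
    rw [← Finset.Iic_top]
    exact hβ.sum_Iic_pairingIn_nonneg ha _

lemma pairingIn_nonneg_of_isPos {a : ι} {m : Fin k}
    (h0 : ∀ l < m, P.pairingIn ℤ a (β l) = 0) (ha : b.IsPos a) : 0 ≤ P.pairingIn ℤ a (β m) := by
  have hsum := hβ.sum_Iic_pairingIn_nonneg ha m
  rwa [Finset.sum_eq_single_of_mem m (by simp)
    fun l hl hlm ↦ h0 l (lt_of_le_of_ne (Finset.mem_Iic.1 hl) hlm)] at hsum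

lemma isPos_of_pairingIn_pos {a : ι} {m : Fin k} (h0 : ∀ l < m, P.pairingIn ℤ a (β l) = 0)
    (hm : 0 < P.pairingIn ℤ a (β m)) : b.IsPos a := by
  let _ := P.indexNeg
  by_contra h
  have hneg (l : Fin k) : P.pairingIn ℤ (-a) (β l) = -P.pairingIn ℤ a (β l) :=
    P.pairingIn_reflectionPerm_self_left ℤ a (β l)
  have := hβ.pairingIn_nonneg_of_isPos (a := -a) (m := m)
    (fun l hl ↦ by rw [hneg, h0 l hl, neg_zero]) ((RootPairing.Base.IsPos.neg_iff_not b a).2 h)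
  rw [hneg] at this
  lia

lemma exists_isPos_pairingIn_eq {a : ι} {l : Fin k} (hl : P.pairingIn ℤ a (β l) ≠ 0) :
    ∃ a' m, b.IsPos a' ∧ P.pairingIn ℤ a' (β m) = |P.pairingIn ℤ a (β m)| ∧
      ∀ q ≠ m, P.pairingIn ℤ a' (β q) = -|P.pairingIn ℤ a (β q)| := by
  obtain ⟨m, -, hm⟩ := exists_minimal_le_of_wellFoundedLT (fun q ↦ P.pairingIn ℤ a (β q) ≠ 0) l hl
  have hsign (q : Fin k) : ∃ u : ℤˣ, u * P.pairingIn ℤ a (β q) = |P.pairingIn ℤ a (β q)| := by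
    rcases abs_choice (P.pairingIn ℤ a (β q)) with h | h
    · exact ⟨1, by simp [h]⟩
    · exact ⟨-1, by simp [h]⟩
  choose u hu using hsign
  obtain ⟨a', ha'⟩ := exists_pairingIn_eq_units_mul hβ.orthogonal
    (fun q ↦ if q = m then u q else -u q) a
  have ham : P.pairingIn ℤ a' (β m) = |P.pairingIn ℤ a (β m)| := by simp [ha', hu]
  have haq (q : Fin k) (hq : q ≠ m) : P.pairingIn ℤ a' (β q) = -|P.pairingIn ℤ a (β q)| := by
    simp [ha', hu, hq]
  refine ⟨a', m, hβ.isPos_of_pairingIn_pos (m := m) (fun q hq ↦ ?_) ?_, ham, haq⟩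
  · simpa [haq q hq.ne] using hm.not_prop_of_lt hq
  · simpa [ham] using hm.prop

omit [IsDomain R] in
lemma pairingIn_reflectionPerm_apply_of_ne {i l : Fin k} (hl : l ≠ i) (a : ι) :
    P.pairingIn ℤ (P.reflectionPerm (β i) a) (β l) = P.pairingIn ℤ a (β l) := by
  rw [pairingIn_reflectionPerm_left, hβ.orthogonal hl.symm, mul_zero, sub_zero]

lemma isPos_reflectionPerm {a : ι} (ha : b.IsPos a) {i l : Fin k} (hli : l < i)
    (hl : P.pairingIn ℤ a (β l) ≠ 0) : b.IsPos (P.reflectionPerm (β i) a) := by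
  obtain ⟨m, hml, hm⟩ :=
    exists_minimal_le_of_wellFoundedLT (fun q ↦ P.pairingIn ℤ a (β q) ≠ 0) l hl
  have hmi : m < i := hml.trans_lt hli
  have hzero (q : Fin k) (hq : q < m) : P.pairingIn ℤ a (β q) = 0 := by
    simpa using hm.not_prop_of_lt hq
  refine hβ.isPos_of_pairingIn_pos (m := m) (fun q hq ↦ ?_) ?_
  · rw [hβ.pairingIn_reflectionPerm_apply_of_ne (hq.trans hmi).ne, hzero q hq]
  · rw [hβ.pairingIn_reflectionPerm_apply_of_ne hmi.ne]
    exact (hβ.pairingIn_nonneg_of_isPos hzero ha).lt_of_ne' hm.prop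

variable [P.IsReduced]

-- Flipping signs by reflections in the sequence makes all but one summand negative.
lemma sum_abs_pairingIn_le_two (a : ι) : ∑ q, |P.pairingIn ℤ a (β q)| ≤ 2 := by
  by_cases h0 : ∀ l, P.pairingIn ℤ a (β l) = 0
  · simp [h0]
  push Not at h0
  obtain ⟨l, hl⟩ := h0
  obtain ⟨a', m, hpos, ham, haq⟩ := hβ.exists_isPos_pairingIn_eq hl
  have hsum := hβ.sum_pairingIn_nonneg hpos
  rw [← Finset.add_sum_erase _ _ (Finset.mem_univ m)] at hsum ⊢
  rw [Finset.sum_congr rfl fun q hq ↦ haq q (Finset.ne_of_mem_erase hq),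
    Finset.sum_neg_distrib] at hsum
  by_cases heq : a' = β m
  · have hzero (q : Fin k) (hq : q ∈ Finset.univ.erase m) : |P.pairingIn ℤ a (β q)| = 0 := by
      rw [← neg_eq_zero, ← haq q (Finset.ne_of_mem_erase hq), heq]
      exact hβ.orthogonal (Finset.ne_of_mem_erase hq).symm
    rw [Finset.sum_congr rfl hzero, ← ham, heq, P.pairingIn_same]
    simp
  · have := (hβ.long m).pairingIn_le_one heq
    lia

lemma abs_pairingIn_sub_sum_mul (a : ι) (i : Fin k) :
    |P.pairingIn ℤ a (β i)| -
        ∑ l ∈ Finset.Iio i, |P.pairingIn ℤ a (β l)| * |P.pairingIn ℤ a (β i)| =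
      if ∀ l < i, P.pairingIn ℤ a (β l) = 0 then |P.pairingIn ℤ a (β i)| else 0 := by
  rw [← Finset.sum_mul]
  split_ifs with h
  · rw [Finset.sum_eq_zero fun l hl ↦ by rw [h l (Finset.mem_Iio.1 hl), abs_zero]]
    ring
  rcases eq_or_ne (P.pairingIn ℤ a (β i)) 0 with h0 | h0
  · simp [h0]
  push Not at h
  obtain ⟨l, hli, hl⟩ := h
  have hle : ∑ l ∈ Finset.Iic i, |P.pairingIn ℤ a (β l)| ≤ 2 :=
    (Finset.sum_le_univ_sum_of_nonneg fun _ ↦ abs_nonneg _).trans (hβ.sum_abs_pairingIn_le_two a)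
  rw [← Finset.Iio_insert, Finset.sum_insert (by simp)] at hle
  have hge := Finset.single_le_sum (fun q _ ↦ abs_nonneg (P.pairingIn ℤ a (β q)))
    (Finset.mem_Iio.2 hli)
  have h1 : ∑ l ∈ Finset.Iio i, |P.pairingIn ℤ a (β l)| = 1 := by
    have := abs_pos.2 hl
    have := abs_pos.2 h0
    lia
  rw [h1]
  ring

lemma pairingIn_eq_zero_of_pairingIn_eq_one {a : ι} {i j l : Fin k} (hij : i ≠ j) (hli : l ≠ i)
    (hlj : l ≠ j) (hi : P.pairingIn ℤ a (β i) = 1) (hj : P.pairingIn ℤ a (β j) = 1) :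
    P.pairingIn ℤ a (β l) = 0 := by
  have hsub := Finset.sum_le_univ_sum_of_nonneg (s := {i, j, l})
    fun q ↦ abs_nonneg (P.pairingIn ℤ a (β q))
  rw [Finset.sum_insert (by simp [hij, hli.symm]), Finset.sum_pair hlj.symm, hi, hj] at hsub
  have := hβ.sum_abs_pairingIn_le_two a
  rw [← abs_eq_zero]
  have := abs_nonneg (P.pairingIn ℤ a (β l))
  simp only [abs_one] at hsub
  lia

lemma exists_pairingIn_eq_one [P.IsIrreducible] {i j : Fin k} (hij : i ≠ j) :
    ∃ a, P.pairingIn ℤ a (β i) = 1 ∧ P.pairingIn ℤ a (β j) = 1 ∧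
      ∀ l, l ≠ i → l ≠ j → P.pairingIn ℤ a (β l) = 0 := by
  obtain ⟨a₀, hi₀, hj₀⟩ := exists_pairingIn_ne_zero (P := P) (β i) (β j)
  obtain ⟨a, ha⟩ := exists_pairingIn_eq_units_mul hβ.orthogonal
    (fun q ↦ if 0 ≤ P.pairingIn ℤ a₀ (β q) then 1 else -1) a₀
  have hpos (q : Fin k) (hq : P.pairingIn ℤ a₀ (β q) ≠ 0) : 0 < P.pairingIn ℤ a (β q) := by
    rw [ha]
    split_ifs <;> simp <;> lia
  have hone {p q : Fin k} (hpq : p ≠ q) (hp : 0 < P.pairingIn ℤ a (β p))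
      (hq : 0 < P.pairingIn ℤ a (β q)) : P.pairingIn ℤ a (β p) = 1 := by
    refine le_antisymm ((hβ.long p).pairingIn_le_one ?_) hp
    rintro rfl
    exact hq.ne' (hβ.orthogonal hpq)
  have hi := hone hij (hpos i hi₀) (hpos j hj₀)
  have hj := hone hij.symm (hpos j hj₀) (hpos i hi₀)
  exact ⟨a, hi, hj, fun l hli hlj ↦ hβ.pairingIn_eq_zero_of_pairingIn_eq_one hij hli hlj hi hj⟩

/- For `a` with pairings `1` on `β i` and `β j`, either `s_a` maps one of the two roots to the
opposite of the other, or both of them are Weyl conjugate to `a`. -/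
lemma apply_eq_apply_of_reflection_invariant [P.IsIrreducible] {X : Type*} (F : ι → X)
    {i j : Fin k} (hF : ∀ c, (∀ l, l ≠ i → l ≠ j → P.pairingIn ℤ c (β l) = 0) →
      ∀ x, F (P.reflectionPerm c x) = F x) :
    F (β i) = F (β j) := by
  rcases eq_or_ne i j with rfl | hij
  · rfl
  obtain ⟨a, hi, hj, hl⟩ := hβ.exists_pairingIn_eq_one hij
  have horth (p l : Fin k) (hlp : l ≠ p) : P.pairingIn ℤ (β p) (β l) = 0 :=
    hβ.orthogonal hlp.symm
  have conj_a (p : Fin k) (hp : P.pairingIn ℤ a (β p) = 1) (h : P.pairingIn ℤ (β p) a = 1)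
      (hp0 : ∀ l, l ≠ i → l ≠ j → P.pairingIn ℤ (β p) (β l) = 0) : F (β p) = F a := by
    rw [← reflectionPerm_reflectionPerm_of_pairingIn_eq_one h hp, hF]
    intro l hli hlj
    simp [pairingIn_reflectionPerm_left, hp0 l hli hlj, hl l hli hlj]
  rcases (hβ.long j).reflectionPerm_eq_or_pairingIn_eq_one (hβ.orthogonal hij) hi hj with h | h
  · rw [← hF a hl, h, hF _ fun l _ hlj ↦ horth j l hlj]
  rcases (hβ.long i).reflectionPerm_eq_or_pairingIn_eq_one (hβ.orthogonal hij.symm) hj hi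
    with h' | h'
  · rw [← hF a hl (β j), h', hF _ fun l hli _ ↦ horth i l hli]
  · rw [conj_a i hi h fun l hli _ ↦ horth i l hli, conj_a j hj h' fun l _ hlj ↦ horth j l hlj]

end Finite

section Fintype

variable [Fintype ι] (hβ : IsDominantOrthogonalSequence b β)
include hβ

-- The reflection in `β i` permutes the omitted roots and changes the signs of their pairings.
lemma sum_isPos_pairingIn [DecidablePred b.IsPos] (i : Fin k) :
    ∑ a with b.IsPos a, P.pairingIn ℤ a (β i) =
      ∑ a with b.IsPos a, if ∀ l < i, P.pairingIn ℤ a (β l) = 0 then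
        P.pairingIn ℤ a (β i) else 0 := by
  let B : Finset ι := {a ∈ ({a | b.IsPos a} : Finset ι) | ¬ ∀ l < i, P.pairingIn ℤ a (β l) = 0}
  have hmaps : ∀ a ∈ B, P.reflectionPerm (β i) a ∈ B := by
    simp only [B, Finset.mem_filter, Finset.mem_univ, true_and]
    rintro a ⟨ha, hne⟩
    push Not at hne ⊢
    obtain ⟨l, hli, hl⟩ := hne
    exact ⟨hβ.isPos_reflectionPerm ha hli hl, l, hli,
      by rwa [hβ.pairingIn_reflectionPerm_apply_of_ne hli.ne]⟩
  have hB : ∑ a ∈ B, P.pairingIn ℤ a (β i) = ∑ a ∈ B, -P.pairingIn ℤ a (β i) := by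
    refine Finset.sum_nbij' _ _ hmaps hmaps (fun a _ ↦ P.reflectionPerm_self _ a)
      (fun a _ ↦ P.reflectionPerm_self _ a) fun a _ ↦ ?_
    rw [pairingIn_reflectionPerm_left, P.pairingIn_same]
    ring
  rw [Finset.sum_neg_distrib, self_eq_neg] at hB
  rw [← Finset.sum_filter, ← Finset.sum_filter_add_sum_filter_not _
    fun a ↦ ∀ l < i, P.pairingIn ℤ a (β l) = 0, hB, add_zero]

variable [P.IsReduced]

lemma two_mul_sum_isPos_pairingIn [DecidablePred b.IsPos] (i : Fin k) :
    2 * ∑ a with b.IsPos a, P.pairingIn ℤ a (β i) =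
      absPairingSum P (β i) - ∑ l ∈ Finset.Iio i, absPairingProdSum P (β l) (β i) := by
  let f (a : ι) : ℤ := if ∀ l < i, P.pairingIn ℤ a (β l) = 0 then |P.pairingIn ℤ a (β i)| else 0
  have hf (a : ι) : f (P.reflectionPerm a a) = f a := by
    simp [f, P.pairingIn_reflectionPerm_self_left]
  calc 2 * ∑ a with b.IsPos a, P.pairingIn ℤ a (β i)
    _ = 2 • ∑ a with b.IsPos a, f a := by
      rw [hβ.sum_isPos_pairingIn, nsmul_eq_mul, Nat.cast_two]
      congr 1
      refine Finset.sum_congr rfl fun a ha ↦ if_ctx_congr Iff.rfl (fun h ↦ ?_) fun _ ↦ rfl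
      exact (abs_of_nonneg (hβ.pairingIn_nonneg_of_isPos h (Finset.mem_filter.1 ha).2)).symm
    _ = ∑ a, f a := (sum_eq_two_nsmul_sum_isPos b hf).symm
    _ = absPairingSum P (β i) - ∑ l ∈ Finset.Iio i, absPairingProdSum P (β l) (β i) := by
      simp only [f, ← hβ.abs_pairingIn_sub_sum_mul, Finset.sum_sub_distrib, absPairingSum,
        absPairingProdSum]
      rw [Finset.sum_comm]

variable [P.IsIrreducible]

lemma absPairingSum_eq (i j : Fin k) : absPairingSum P (β i) = absPairingSum P (β j) :=
  hβ.apply_eq_apply_of_reflection_invariant _ fun c _ ↦ absPairingSum_reflectionPerm c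

lemma exists_absPairingProdSum_eq :
    ∃ d, ∀ i j, i ≠ j → absPairingProdSum P (β i) (β j) = d := by
  have hswap {i j l : Fin k} (hi : i ≠ l) (hj : j ≠ l) :
      absPairingProdSum P (β l) (β i) = absPairingProdSum P (β l) (β j) := by
    refine hβ.apply_eq_apply_of_reflection_invariant _ fun c hc x ↦ ?_
    have hfix : P.reflectionPerm c (β l) = β l :=
      reflectionPerm_eq_self_of_pairingIn_eq_zero
        (pairingIn_eq_zero_comm (hc l hi.symm hj.symm))
    nth_rw 1 [← hfix]
    exact absPairingProdSum_reflectionPerm c (β l) x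
  by_cases h : ∃ p q : Fin k, p ≠ q
  · obtain ⟨p, q, hpq⟩ := h
    refine ⟨absPairingProdSum P (β p) (β q), fun i j hij ↦ ?_⟩
    rcases eq_or_ne i p with rfl | hip
    · exact hswap hij.symm hpq.symm
    · rw [hswap hij.symm hip.symm, absPairingProdSum_comm, hswap hip hpq.symm]
  · exact ⟨0, fun i j hij ↦ (h ⟨i, j, hij⟩).elim⟩

theorem exists_two_mul_sum_isPos_pairingIn_eq [DecidablePred b.IsPos] :
    ∃ c d : ℤ, ∀ i : Fin k, 2 * ∑ a with b.IsPos a, P.pairingIn ℤ a (β i) = c - i * d := by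
  obtain ⟨d, hd⟩ := hβ.exists_absPairingProdSum_eq
  cases k with
  | zero => exact ⟨0, d, fun i ↦ i.elim0⟩
  | succ k =>
    refine ⟨absPairingSum P (β 0), d, fun i ↦ ?_⟩
    rw [hβ.two_mul_sum_isPos_pairingIn, hβ.absPairingSum_eq i 0,
      Finset.sum_congr rfl fun l hl ↦ hd l i (Finset.mem_Iio.1 hl).ne, Finset.sum_const,
      Fin.card_Iio, nsmul_eq_mul]

end Fintype

end IsDominantOrthogonalSequence

end DominantOrthogonalSequences

section CasimirValue

variable {ι R M N : Type*} [CommRing R]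
  [AddCommGroup M] [Module R M] [AddCommGroup N] [Module R N]
  {P : RootPairing ι R M N} [P.IsCrystallographic]

lemma four_mul_form_root_sum_root (B : P.InvariantForm) (i : ι) (s : Finset ι) :
    4 * B.form (P.root i) (∑ a ∈ s, P.root a) =
      B.form (P.root i) (P.root i) * (2 * ∑ a ∈ s, P.pairingIn ℤ a i : ℤ) := by
  have hterm (a : ι) : 2 * B.form (P.root i) (P.root a) =
      B.form (P.root i) (P.root i) * (P.pairingIn ℤ a i : R) := by
    rw [B.two_mul_apply_root_root, ← B.pairing_mul_eq_pairing_mul_swap,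
      ← P.algebraMap_pairingIn ℤ, eq_intCast, mul_comm]
  push_cast
  rw [mul_left_comm, Finset.mul_sum, ← Finset.sum_congr rfl fun a _ ↦ hterm a, map_sum,
    ← Finset.mul_sum]
  ring

open scoped Classical in
/-- The value `(μ, μ + 2ρ)` of the Casimir operator on the irreducible representation of highest
weight `μ`, where `2ρ` is the sum of the positive roots. -/
def casimirValue [Fintype ι] [CharZero R] (b : P.Base) (B : LinearMap.BilinForm R M) (μ : M) : R :=
  B μ (μ + ∑ a with b.IsPos a, P.root a)

end CasimirValue

section CasimirValueOfDominantOrthogonalSequence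

variable {ι R M N : Type*} [Field R] [CharZero R]
  [AddCommGroup M] [Module R M] [AddCommGroup N] [Module R N]
  {P : RootPairing ι R M N} [P.IsCrystallographic]

namespace IsDominantOrthogonalSequence

variable {b : P.Base} {k : ℕ} {β : Fin k → ι}

lemma form_root_eq_zero [Finite ι] (hβ : IsDominantOrthogonalSequence b β) (B : P.InvariantForm)
    {i j : Fin k} (hij : i ≠ j) : B.form (P.root (β i)) (P.root (β j)) = 0 := by
  rw [B.apply_root_root_zero_iff, ← P.algebraMap_pairingIn ℤ, hβ.orthogonal hij, map_zero]

variable [P.IsReduced] [P.IsIrreducible]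

lemma form_root_self_eq [Finite ι] (hβ : IsDominantOrthogonalSequence b β) (B : P.InvariantForm)
    (i j : Fin k) : B.form (P.root (β i)) (P.root (β i)) = B.form (P.root (β j)) (P.root (β j)) :=
  hβ.apply_eq_apply_of_reflection_invariant (fun a ↦ B.form (P.root a) (P.root a))
    fun c _ a ↦ by rw [P.root_reflectionPerm, B.apply_reflection_reflection]

theorem exists_casimirValue_sum_root_eq [Fintype ι] (hβ : IsDominantOrthogonalSequence b β)
    (B : P.InvariantForm) : ∃ c d : R, ∀ s : Finset (Fin k),
      casimirValue b B.form (∑ i ∈ s, P.root (β i)) = ∑ i ∈ s, (c - i * d) := by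
  classical
  obtain ⟨Q, hQ⟩ : ∃ Q, ∀ i, B.form (P.root (β i)) (P.root (β i)) = Q := by
    cases k with
    | zero => exact ⟨0, fun i ↦ i.elim0⟩
    | succ k => exact ⟨_, fun i ↦ hβ.form_root_self_eq B i 0⟩
  obtain ⟨c, d, hcd⟩ := hβ.exists_two_mul_sum_isPos_pairingIn_eq
  refine ⟨Q + Q * c / 4, Q * d / 4, fun s ↦ ?_⟩
  rw [casimirValue, map_sum, LinearMap.sum_apply]
  refine Finset.sum_congr rfl fun i hi ↦ ?_
  have hself : B.form (P.root (β i)) (∑ j ∈ s, P.root (β j)) = Q := by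
    rw [map_sum, Finset.sum_eq_single_of_mem i hi fun j _ hj ↦ hβ.form_root_eq_zero B hj.symm, hQ]
  have hpos := four_mul_form_root_sum_root B (β i) {a | b.IsPos a}
  rw [hcd, hQ] at hpos
  push_cast at hpos
  rw [map_add, hself]
  linear_combination hpos / 4

end IsDominantOrthogonalSequence

end CasimirValueOfDominantOrthogonalSequence

section BilinearForms

variable {K V : Type*} [Field K] [AddCommGroup V] [Module K V]
  (B : LinearMap.BilinForm K V) (hB : B.Nondegenerate)

lemma sum_apply_smul_dualBasis {ι : Type*} [Fintype ι] [DecidableEq ι] (e : Basis ι K V) (x : V) :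
    ∑ i, B x (e i) • B.dualBasis hB e i = x := by
  simpa only [LinearMap.BilinForm.dualBasis_repr_apply] using (B.dualBasis hB e).sum_repr x

lemma sum_dualBasis_apply_smul {ι : Type*} [Fintype ι] [DecidableEq ι] (e : Basis ι K V) (x : V) :
    ∑ i, B (B.dualBasis hB e i) x • e i = x := by
  have hcoord (i : ι) : B (B.dualBasis hB e i) = e.coord i := e.ext fun j ↦ by
    rw [LinearMap.BilinForm.apply_dualBasis_left, Basis.coord_apply, Basis.repr_self,
      Finsupp.single_apply]
  simpa only [hcoord, Basis.coord_apply] using e.sum_repr x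

variable [FiniteDimensional K V]

/-- The form which the dual of `V` inherits from a nondegenerate form `B` on `V`: the value of
`dualForm B hB` at `μ` and `ν` is `μ (t_ν)`, where `t_ν` is determined by `B t_ν = ν`. -/
def dualForm : LinearMap.BilinForm K (Dual K V) :=
  LinearMap.lcomp K K ((B.toDual hB).symm : Dual K V →ₗ[K] V)

variable {B}

lemma dualForm_apply (μ ν : Dual K V) : dualForm B hB μ ν = μ ((B.toDual hB).symm ν) := rfl

lemma dualForm_isSymm (hsymm : B.IsSymm) : (dualForm B hB).IsSymm where
  eq μ ν := by
    rw [dualForm_apply, dualForm_apply,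
      ← LinearMap.BilinForm.apply_toDual_symm_apply (hB := hB) μ,
      ← LinearMap.BilinForm.apply_toDual_symm_apply (hB := hB) ν, hsymm.eq]

lemma sum_apply_mul_apply_dualBasis (hsymm : B.IsSymm) {ι : Type*} [Fintype ι] [DecidableEq ι]
    (e : Basis ι K V) (μ ν : Dual K V) :
    ∑ i, μ (e i) * ν (B.dualBasis hB e i) = dualForm B hB μ ν := by
  rw [dualForm_apply]
  conv_rhs => rw [← sum_dualBasis_apply_smul B hB e ((B.toDual hB).symm ν), map_sum]
  refine Finset.sum_congr rfl fun i _ ↦ ?_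
  rw [map_smul, smul_eq_mul, mul_comm, hsymm.eq,
    LinearMap.BilinForm.apply_toDual_symm_apply]

/-- Invariance of the tensor `∑ i, eᵢ ⊗ eⁱ` behind the Casimir operator. -/
lemma sum_map_lie_dualBasis_eq_zero {L W ι : Type*} [LieRing L] [LieAlgebra K L]
    [AddCommGroup W] [Module K W] [Fintype ι] [DecidableEq ι]
    {Φ : LinearMap.BilinForm K L} (hΦ : Φ.Nondegenerate) (hinv : Φ.lieInvariant L)
    (e : Basis ι K L) (T : L →ₗ[K] L →ₗ[K] W) (x : L) :
    ∑ i, (T ⁅x, e i⁆ (Φ.dualBasis hΦ e i) + T (e i) ⁅x, Φ.dualBasis hΦ e i⁆) = 0 := by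
  let f := Φ.dualBasis hΦ e
  have hleft (i) : T ⁅x, e i⁆ (f i) = ∑ j, Φ (f j) ⁅x, e i⁆ • T (e j) (f i) := by
    conv_lhs => rw [← sum_dualBasis_apply_smul Φ hΦ e ⁅x, e i⁆]
    simp only [map_sum, map_smul, LinearMap.sum_apply, LinearMap.smul_apply, f]
  have hright (i) : T (e i) ⁅x, f i⁆ = ∑ j, Φ ⁅x, f i⁆ (e j) • T (e i) (f j) := by
    conv_lhs => rw [← sum_apply_smul_dualBasis Φ hΦ e ⁅x, f i⁆]
    simp only [map_sum, map_smul, f]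
  calc ∑ i, (T ⁅x, e i⁆ (f i) + T (e i) ⁅x, f i⁆)
      = ∑ i, ∑ j, (Φ (f i) ⁅x, e j⁆ + Φ ⁅x, f i⁆ (e j)) • T (e i) (f j) := by
        simp only [hleft, hright, add_smul, Finset.sum_add_distrib]
        rw [Finset.sum_comm]
    _ = 0 := by simp only [hinv x (f _) (e _), add_neg_cancel, zero_smul, Finset.sum_const_zero]

end BilinearForms

section CasimirOperator

variable {L : Type*} [LieRing L] [LieAlgebra ℂ L] [FiniteDimensional ℂ L]
  {Φ : LinearMap.BilinForm ℂ L} (hΦ : Φ.Nondegenerate)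
  {M : Type*} [AddCommGroup M] [Module ℂ M] [LieRingModule L M] [LieModule ℂ L M]

lemma casimir_apply (m : M) : casimir Φ hΦ M m =
    ∑ i, ⁅finBasis ℂ L i, ⁅Φ.dualBasis hΦ (finBasis ℂ L) i, m⁆⁆ := by
  simp only [casimir, LinearMap.sum_apply, LinearMap.comp_apply, toEnd_apply_apply]

lemma casimir_apply_eq_sum {κ : Type*} [Fintype κ] {u w : κ → L}
    (h : ∀ y, ∑ j, Φ (w j) y • u j = y) (m : M) :
    casimir Φ hΦ M m = ∑ j, ⁅u j, ⁅w j, m⁆⁆ := by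
  have hw (j : κ) : ⁅u j, ⁅w j, m⁆⁆ = ∑ i, ⁅Φ (w j) (finBasis ℂ L i) • u j,
      ⁅Φ.dualBasis hΦ (finBasis ℂ L) i, m⁆⁆ := by
    conv_lhs => rw [← sum_apply_smul_dualBasis Φ hΦ (finBasis ℂ L) (w j)]
    simp only [sum_lie, lie_sum, smul_lie, lie_smul]
  simp only [casimir_apply, hw]
  rw [Finset.sum_comm]
  simp only [← sum_lie, h]

lemma casimir_lie (hinv : Φ.lieInvariant L) (x : L) (m : M) :
    casimir Φ hΦ M ⁅x, m⁆ = ⁅x, casimir Φ hΦ M m⁆ := by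
  let e := finBasis ℂ L
  let f := Φ.dualBasis hΦ e
  let T : L →ₗ[ℂ] L →ₗ[ℂ] M := LinearMap.mk₂ ℂ (fun y z ↦ ⁅y, ⁅z, m⁆⁆) (by simp) (by simp)
    (by simp) (by simp)
  have hT : ∑ i, (⁅⁅x, e i⁆, ⁅f i, m⁆⁆ + ⁅e i, ⁅⁅x, f i⁆, m⁆⁆) = 0 :=
    sum_map_lie_dualBasis_eq_zero hΦ hinv e T x
  have hleibniz (i) : ⁅x, ⁅e i, ⁅f i, m⁆⁆⁆ =
      (⁅⁅x, e i⁆, ⁅f i, m⁆⁆ + ⁅e i, ⁅⁅x, f i⁆, m⁆⁆) + ⁅e i, ⁅f i, ⁅x, m⁆⁆⁆ := by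
    rw [leibniz_lie x (e i), leibniz_lie x (f i), lie_add, add_assoc]
  calc casimir Φ hΦ M ⁅x, m⁆ = ∑ i, ⁅e i, ⁅f i, ⁅x, m⁆⁆⁆ := casimir_apply hΦ _
    _ = ∑ i, ⁅x, ⁅e i, ⁅f i, m⁆⁆⁆ := by
        simp only [hleibniz, Finset.sum_add_distrib (g := fun i ↦ ⁅e i, ⁅f i, ⁅x, m⁆⁆⁆), hT,
          zero_add]
    _ = ⁅x, casimir Φ hΦ M m⁆ := by rw [casimir_apply, lie_sum]

lemma hasCasimirEigenvalue_of_isIrreducible (hinv : Φ.lieInvariant L)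
    [LieModule.IsIrreducible ℂ L M] {c : ℂ} {v : M} (hv : v ≠ 0)
    (h : casimir Φ hΦ M v = c • v) : HasCasimirEigenvalue Φ hΦ M c := by
  let C : M →ₗ⁅ℂ,L⁆ M := { casimir Φ hΦ M with map_lie' := casimir_lie hΦ hinv _ _ }
  have mem_ker (m : M) : m ∈ (C - c • LieModuleHom.id).ker ↔ casimir Φ hΦ M m = c • m := by
    rw [LieModuleHom.mem_ker]
    exact sub_eq_zero
  have ker_ne_bot : (C - c • LieModuleHom.id).ker ≠ ⊥ := fun hbot ↦
    hv ((LieSubmodule.mem_bot v).1 (hbot ▸ (mem_ker v).2 h))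
  have ker_eq_top := (IsSimpleOrder.eq_bot_or_eq_top _).resolve_left ker_ne_bot
  exact fun m ↦ (mem_ker m).1 (ker_eq_top ▸ LieSubmodule.mem_top m)

end CasimirOperator

section RootSpaces

variable {K L : Type*} [Field K] [LieRing L] [LieAlgebra K L] [FiniteDimensional K L]
  {H : LieSubalgebra K L} [H.IsCartanSubalgebra] [IsTriangularizable K H L]
  {Φ : LinearMap.BilinForm K L}

lemma linearMap_ext_rootSpace {V : Type*} [AddCommGroup V] [Module K V] {f g : L →ₗ[K] V}
    (h : ∀ χ : Weight K H L, ∀ x ∈ rootSpace H χ, f x = g x) : f = g := by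
  ext x
  have hx : x ∈ ⨆ χ : Weight K H L, rootSpace H χ := by
    rw [iSup_genWeightSpace_eq_top' K H L]
    exact LieSubmodule.mem_top x
  induction hx using LieSubmodule.iSup_induction' with
  | zero => rw [map_zero, map_zero]
  | mem χ y hy => exact h χ y hy
  | add y z _ _ hy hz => rw [map_add, map_add, hy, hz]

omit [IsTriangularizable K H L] in
lemma coe_mem_rootSpace_zero (h : H) : (h : L) ∈ rootSpace H (0 : H → K) := by
  rw [rootSpace_zero_eq K L H]
  exact h.2

variable [IsKilling K L] [PerfectField K]

lemma apply_eq_zero_of_mem_rootSpace (hinv : Φ.lieInvariant L) {χ ψ : H → K} (hne : χ + ψ ≠ 0)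
    {x y : L} (hx : x ∈ rootSpace H χ) (hy : y ∈ rootSpace H ψ) : Φ x y = 0 := by
  obtain ⟨h, hh⟩ := Function.ne_iff.1 hne
  have hx' : ⁅(h : L), x⁆ = χ h • x := IsKilling.lie_eq_smul_of_mem_rootSpace hx h
  have hy' : ⁅(h : L), y⁆ = ψ h • y := IsKilling.lie_eq_smul_of_mem_rootSpace hy h
  have hΦ := hinv (h : L) x y
  rw [hx', hy', map_smul, map_smul, LinearMap.smul_apply, smul_eq_mul, smul_eq_mul,
    eq_neg_iff_add_eq_zero, ← add_mul] at hΦ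
  exact (mul_eq_zero.1 hΦ).resolve_left hh

lemma eq_zero_of_forall_rootSpace_neg (hΦ : Φ.Nondegenerate) (hinv : Φ.lieInvariant L)
    {χ : H → K} {x : L} (hx : x ∈ rootSpace H χ) (h : ∀ y ∈ rootSpace H (-χ), Φ x y = 0) :
    x = 0 := by
  have hzero : Φ x = 0 := linearMap_ext_rootSpace (H := H) fun ψ y hy ↦ by
    by_cases hψ : χ + ψ = 0
    · exact h y (by rwa [← eq_neg_of_add_eq_zero_right hψ])
    · exact apply_eq_zero_of_mem_rootSpace hinv hψ hx hy
  exact hΦ.1 x fun y ↦ by rw [hzero, LinearMap.zero_apply]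

variable (H) in
lemma restrict_cartan_nondegenerate (hΦ : Φ.Nondegenerate) (hsymm : Φ.IsSymm)
    (hinv : Φ.lieInvariant L) : (Φ.restrict H.toSubmodule).Nondegenerate := by
  have hleft (h : H) (hh : ∀ h' : H, Φ h h' = 0) : h = 0 := by
    refine Subtype.ext (eq_zero_of_forall_rootSpace_neg hΦ hinv (coe_mem_rootSpace_zero h) ?_)
    intro y hy
    rw [neg_zero, rootSpace_zero_eq K L H] at hy
    exact hh ⟨y, hy⟩
  exact ⟨hleft, fun h hh ↦ hleft h fun h' ↦ (hsymm.eq _ _).trans (hh h')⟩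

variable (hΦ : Φ.Nondegenerate) (hsymm : Φ.IsSymm) (hinv : Φ.lieInvariant L)

variable (H) in
/-- The isomorphism of `H` with its dual given by an invariant form `Φ` on `L`, the analogue for
`Φ` of `LieAlgebra.IsKilling.cartanEquivDual`. -/
def formEquivDual : H ≃ₗ[K] Dual K H :=
  (Φ.restrict H.toSubmodule).toDual (restrict_cartan_nondegenerate H hΦ hsymm hinv)

lemma apply_formEquivDual_symm (μ : Dual K H) (h : H) :
    Φ ((formEquivDual H hΦ hsymm hinv).symm μ) h = μ h :=
  LinearMap.BilinForm.apply_toDual_symm_apply (B := Φ.restrict H.toSubmodule) μ h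

variable (H) in
/-- The form `(μ, ν)` on the dual of `H` induced by an invariant form `Φ` on `L`. -/
def cartanDualForm : LinearMap.BilinForm K (Dual K H) :=
  dualForm (Φ.restrict H.toSubmodule) (restrict_cartan_nondegenerate H hΦ hsymm hinv)

lemma cartanDualForm_apply (μ ν : Dual K H) :
    cartanDualForm H hΦ hsymm hinv μ ν = μ ((formEquivDual H hΦ hsymm hinv).symm ν) := rfl

lemma cartanDualForm_isSymm : (cartanDualForm H hΦ hsymm hinv).IsSymm :=
  dualForm_isSymm (restrict_cartan_nondegenerate H hΦ hsymm hinv) (hsymm.restrict _)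

lemma lie_eq_smul_formEquivDual_symm {α : Weight K H L} {x y : L}
    (hx : x ∈ rootSpace H α) (hy : y ∈ rootSpace H (-α)) :
    ⁅x, y⁆ = Φ x y • ((formEquivDual H hΦ hsymm hinv).symm α.toLinear : L) := by
  set tα := (formEquivDual H hΦ hsymm hinv).symm α.toLinear
  have hmem : ⁅x, y⁆ - Φ x y • (tα : L) ∈ rootSpace H (0 : H → K) := by
    refine sub_mem ?_ (Submodule.smul_mem _ _ (coe_mem_rootSpace_zero tα))
    simpa only [add_neg_cancel] using lie_mem_genWeightSpace_of_mem_genWeightSpace hx hy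
  refine sub_eq_zero.1 (eq_zero_of_forall_rootSpace_neg hΦ hinv hmem fun z hz ↦ ?_)
  rw [neg_zero, rootSpace_zero_eq K L H] at hz
  have hxz : ⁅z, x⁆ = α ⟨z, hz⟩ • x := IsKilling.lie_eq_smul_of_mem_rootSpace hx ⟨z, hz⟩
  have htα : Φ (tα : L) z = α ⟨z, hz⟩ := apply_formEquivDual_symm hΦ hsymm hinv _ ⟨z, hz⟩
  rw [map_sub, LinearMap.sub_apply, map_smul, LinearMap.smul_apply, htα, hinv, ← lie_skew, hxz,
    map_neg, neg_neg, map_smul, hsymm.eq, smul_eq_mul, smul_eq_mul, mul_comm, sub_self]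

variable [CharZero K]

lemma exists_apply_coroot_eq_mul_cartanDualForm (α : H.root) : ∃ c : K, ∀ μ : Dual K H,
    μ (IsKilling.coroot α.1) = c * cartanDualForm H hΦ hsymm hinv μ α.1.toLinear := by
  have hα := LieSubalgebra.isNonZero_coe_root α
  obtain ⟨h, e, f, ht, he, hf⟩ := IsKilling.exists_isSl2Triple_of_weight_isNonZero hα
  have hcoroot : IsKilling.coroot α.1 =
      Φ e f • (formEquivDual H hΦ hsymm hinv).symm α.1.toLinear := by
    refine Subtype.ext ?_
    rw [← ht.h_eq_coroot hα he hf, ← ht.lie_e_f]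
    exact lie_eq_smul_formEquivDual_symm hΦ hsymm hinv he hf
  exact ⟨Φ e f, fun μ ↦ by rw [hcoroot, map_smul, smul_eq_mul, cartanDualForm_apply]⟩

lemma cartanDualForm_root_self_ne_zero (α : H.root) :
    cartanDualForm H hΦ hsymm hinv α.1.toLinear α.1.toLinear ≠ 0 := by
  obtain ⟨c, hc⟩ := exists_apply_coroot_eq_mul_cartanDualForm hΦ hsymm hinv α
  intro hzero
  refine two_ne_zero (α := K) ?_
  calc (2 : K) = α.1 (IsKilling.coroot α.1) :=
        (IsKilling.root_apply_coroot (LieSubalgebra.isNonZero_coe_root α)).symm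
    _ = 0 := by rw [← Weight.toLinear_apply, hc, hzero, mul_zero]

lemma two_mul_cartanDualForm_root (α : H.root) (μ : Dual K H) :
    2 * cartanDualForm H hΦ hsymm hinv μ α.1.toLinear = μ (IsKilling.coroot α.1) *
      cartanDualForm H hΦ hsymm hinv α.1.toLinear α.1.toLinear := by
  obtain ⟨c, hc⟩ := exists_apply_coroot_eq_mul_cartanDualForm hΦ hsymm hinv α
  have htwo := hc α.1.toLinear
  rw [Weight.toLinear_apply,
    IsKilling.root_apply_coroot (LieSubalgebra.isNonZero_coe_root α)] at htwo
  rw [htwo, hc]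
  ring

variable (H) in
/-- The form on the dual of `H` induced by `Φ`, as an invariant form of the root system. -/
def cartanInvariantForm : (IsKilling.rootSystem H).InvariantForm where
  form := cartanDualForm H hΦ hsymm hinv
  symm := LinearMap.BilinForm.isSymm_iff.1 (cartanDualForm_isSymm hΦ hsymm hinv)
  ne_zero := cartanDualForm_root_self_ne_zero hΦ hsymm hinv
  isOrthogonal_reflection α μ ν := by
    have hμ := two_mul_cartanDualForm_root hΦ hsymm hinv α μ
    have hν := two_mul_cartanDualForm_root hΦ hsymm hinv α ν
    have hreflection (ξ : Dual K H) : (IsKilling.rootSystem H).reflection α ξ =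
        ξ - ξ (IsKilling.coroot α.1) • α.1.toLinear := (IsKilling.rootSystem H).reflection_apply α ξ
    simp only [hreflection, map_sub, map_smul, LinearMap.sub_apply, LinearMap.smul_apply,
      smul_eq_mul, (cartanDualForm_isSymm hΦ hsymm hinv).eq α.1.toLinear ν]
    linear_combination (-ν (IsKilling.coroot α.1) / 2) * hμ - (μ (IsKilling.coroot α.1) / 2) * hν

/-- Root vectors `e α` and `f α`, of weights `α` and `-α`, normalized by `Φ (e α) (f α) = 1`. -/
structure IsDualRootVectors (Φ : LinearMap.BilinForm K L) (e f : H.root → L) : Prop where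
  mem_rootSpace : ∀ α, e α ∈ rootSpace H α.1
  mem_rootSpace_neg : ∀ α, f α ∈ rootSpace H (-α.1)
  apply_eq_one : ∀ α, Φ (e α) (f α) = 1

include hΦ hinv in
omit [CharZero K] in
lemma exists_isDualRootVectors : ∃ e f : H.root → L, IsDualRootVectors Φ e f := by
  have hexists (α : H.root) : ∃ x ∈ rootSpace H α.1, ∃ y ∈ rootSpace H (-α.1), Φ x y = 1 := by
    obtain ⟨x, hx, hx0⟩ := α.1.exists_ne_zero
    obtain ⟨y, hy, hxy⟩ : ∃ y ∈ rootSpace H (-α.1), Φ x y ≠ 0 := by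
      by_contra! h
      exact hx0 (eq_zero_of_forall_rootSpace_neg hΦ hinv hx h)
    refine ⟨x, hx, (Φ x y)⁻¹ • y, Submodule.smul_mem _ _ hy, ?_⟩
    rw [map_smul, smul_eq_mul, inv_mul_cancel₀ hxy]
  choose e he f hf h using hexists
  exact ⟨e, f, he, hf, h⟩

namespace IsDualRootVectors

variable {e f : H.root → L}

omit [PerfectField K] in
lemma apply_smul_eq_self (h : IsDualRootVectors Φ e f) {α : H.root} {x : L}
    (hx : x ∈ rootSpace H α.1) : Φ x (f α) • e α = x := by
  have he0 : e α ≠ 0 := fun h0 ↦ by simpa [h0] using h.apply_eq_one α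
  have hdim := IsKilling.finrank_rootSpace_eq_one α.1 (LieSubalgebra.isNonZero_coe_root α)
  obtain ⟨c, hc⟩ := (finrank_eq_one_iff_of_nonzero' ⟨e α, h.mem_rootSpace α⟩
    (fun h0 ↦ he0 (congrArg Subtype.val h0))).1 hdim ⟨x, hx⟩
  have hcx : c • e α = x := congrArg Subtype.val hc
  rw [← hcx, map_smul, LinearMap.smul_apply, h.apply_eq_one, smul_eq_mul, mul_one]

omit [CharZero K] in
lemma apply_eq_zero_of_ne (h : IsDualRootVectors Φ e f) (hinv : Φ.lieInvariant L) {α : H.root}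
    {χ : H → K} (hχ : χ ≠ α.1) {x : L} (hx : x ∈ rootSpace H χ) : Φ (f α) x = 0 := by
  refine apply_eq_zero_of_mem_rootSpace hinv ?_ (h.mem_rootSpace_neg α) hx
  rwa [neg_add_eq_sub, sub_ne_zero]

lemma sum_add_sum_eq_self (h : IsDualRootVectors Φ e f) {ι : Type*} [Fintype ι] [DecidableEq ι]
    (u : Basis ι K H) (z : L) :
    ∑ i, Φ ((Φ.restrict H.toSubmodule).dualBasis
        (restrict_cartan_nondegenerate H hΦ hsymm hinv) u i) z • (u i : L) +
      ∑ α, Φ (f α) z • e α = z := by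
  have hB := restrict_cartan_nondegenerate H hΦ hsymm hinv
  set w := (Φ.restrict H.toSubmodule).dualBasis hB u
  have hext : ∑ i, (Φ (w i)).smulRight (u i : L) + ∑ α, (Φ (f α)).smulRight (e α) =
      LinearMap.id := by
    refine linearMap_ext_rootSpace (H := H) fun χ x hx ↦ ?_
    simp only [LinearMap.add_apply, LinearMap.sum_apply, LinearMap.smulRight_apply,
      LinearMap.id_apply]
    by_cases hχ : χ.IsZero
    · have hf (α : H.root) : Φ (f α) x = 0 := h.apply_eq_zero_of_ne hinv
        (fun hα ↦ LieSubalgebra.isNonZero_coe_root α (hα.symm.trans hχ)) hx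
      rw [hχ, rootSpace_zero_eq K L H] at hx
      simp only [hf, zero_smul, Finset.sum_const_zero, add_zero]
      have hx_eq := congrArg H.toSubmodule.subtype (sum_dualBasis_apply_smul _ hB u ⟨x, hx⟩)
      rwa [map_sum] at hx_eq
    · let β : H.root := ⟨χ, by simpa using hχ⟩
      have hw (i) : Φ (w i) x = 0 := apply_eq_zero_of_mem_rootSpace hinv
        (by rwa [zero_add]) (coe_mem_rootSpace_zero (w i)) hx
      have hf (α : H.root) (hα : α ≠ β) : Φ (f α) x = 0 := h.apply_eq_zero_of_ne hinv
        (fun hχα ↦ hα (Subtype.ext (DFunLike.coe_injective hχα.symm))) hx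
      simp only [hw, zero_smul, Finset.sum_const_zero, zero_add]
      rw [Fintype.sum_eq_single β fun α hα ↦ by rw [hf α hα, zero_smul], hsymm.eq]
      exact h.apply_smul_eq_self (α := β) hx
  simpa only [LinearMap.add_apply, LinearMap.sum_apply, LinearMap.smulRight_apply,
      LinearMap.id_apply] using LinearMap.congr_fun hext z

end IsDualRootVectors

end RootSpaces

section HighestWeightVectors

variable {L : Type*} [LieRing L] [LieAlgebra ℂ L] [FiniteDimensional ℂ L] [IsSimple ℂ L]
  {H : LieSubalgebra ℂ L} [H.IsCartanSubalgebra] {b : (IsKilling.rootSystem H).Base}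
  {Φ : LinearMap.BilinForm ℂ L} (hΦ : Φ.Nondegenerate) (hsymm : Φ.IsSymm)
  (hinv : Φ.lieInvariant L)
  {M : Type*} [AddCommGroup M] [Module ℂ M] [LieRingModule L M] {μ : Dual ℂ H} {v : M}

variable (b μ v) in
/-- The vector `v` has weight `μ` and is annihilated by the positive root spaces. A nonzero such
`v` is a highest weight vector, as in `HasHighestWeightVector`. -/
structure IsPrimitiveVector : Prop where
  lie_cartan : ∀ h : H, ⁅(h : L), v⁆ = μ h • v
  lie_eq_zero_of_isPos : ∀ α : H.root, b.IsPos α → ∀ x ∈ rootSpace H α.1, ⁅x, v⁆ = 0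

namespace IsPrimitiveVector

lemma lie_eq_zero_of_not_isPos (hv : IsPrimitiveVector b μ v) {α : H.root} (hα : ¬ b.IsPos α)
    {x : L} (hx : x ∈ rootSpace H (-α.1)) : ⁅x, v⁆ = 0 := by
  let _ := (IsKilling.rootSystem H).indexNeg
  have hneg : (((-α : H.root) : Weight ℂ H L) : H → ℂ) = -α.1 := by
    have hroot := (IsKilling.rootSystem H).root_reflectionPerm α α
    rw [RootPairing.reflection_apply_self] at hroot
    exact congrArg (fun φ : Dual ℂ H ↦ (φ : H → ℂ)) hroot
  exact hv.lie_eq_zero_of_isPos (-α) ((RootPairing.Base.IsPos.neg_iff_not b α).2 hα) x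
    (hneg ▸ hx)

lemma lie_lie_of_isPos (hv : IsPrimitiveVector b μ v) {e f : H.root → L}
    (h : IsDualRootVectors Φ e f) {α : H.root} (hα : b.IsPos α) :
    ⁅e α, ⁅f α, v⁆⁆ = cartanDualForm H hΦ hsymm hinv μ α.1.toLinear • v := by
  rw [leibniz_lie, hv.lie_eq_zero_of_isPos α hα _ (h.mem_rootSpace α), lie_zero, add_zero,
    lie_eq_smul_formEquivDual_symm hΦ hsymm hinv (h.mem_rootSpace α) (h.mem_rootSpace_neg α),
    h.apply_eq_one, one_smul, hv.lie_cartan, cartanDualForm_apply]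

variable [LieModule ℂ L M]

theorem casimir_apply_eq_smul (hv : IsPrimitiveVector b μ v) :
    casimir Φ hΦ M v = casimirValue b (cartanInvariantForm H hΦ hsymm hinv).form μ • v := by
  classical
  obtain ⟨e, f, hef⟩ := exists_isDualRootVectors (H := H) hΦ hinv
  let B := Φ.restrict H.toSubmodule
  have hB : B.Nondegenerate := restrict_cartan_nondegenerate H hΦ hsymm hinv
  let u := finBasis ℂ H
  let w := B.dualBasis hB u
  have hcartan : ∑ i, ⁅(u i : L), ⁅(w i : L), v⁆⁆ = cartanDualForm H hΦ hsymm hinv μ μ • v := by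
    simp only [hv.lie_cartan, lie_smul, smul_smul, ← Finset.sum_smul]
    congr 1
    exact (Finset.sum_congr rfl fun i _ ↦ mul_comm _ _).trans
      (sum_apply_mul_apply_dualBasis hB (hsymm.restrict _) u μ μ)
  have hroots : ∑ α, ⁅e α, ⁅f α, v⁆⁆ =
      cartanDualForm H hΦ hsymm hinv μ (∑ α with b.IsPos α, α.1.toLinear) • v := by
    rw [map_sum, Finset.sum_smul, Finset.sum_filter]
    refine Finset.sum_congr rfl fun α _ ↦ ?_
    split_ifs with hα
    · exact hv.lie_lie_of_isPos hΦ hsymm hinv hef hα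
    · rw [hv.lie_eq_zero_of_not_isPos hα (hef.mem_rootSpace_neg α), lie_zero]
  have hdual (z : L) : ∑ j, Φ (Sum.elim (fun i ↦ (w i : L)) f j) z •
      Sum.elim (fun i ↦ (u i : L)) e j = z := by
    rw [Fintype.sum_sum_type]
    exact hef.sum_add_sum_eq_self hΦ hsymm hinv u z
  rw [casimir_apply_eq_sum hΦ hdual, Fintype.sum_sum_type]
  simp only [Sum.elim_inl, Sum.elim_inr]
  rw [hcartan, hroots, ← add_smul, ← map_add]
  rfl

end IsPrimitiveVector

variable [LieModule ℂ L M]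

lemma HasCasimirEigenvalue.eq_casimirValue {c : ℂ} (hc : HasCasimirEigenvalue Φ hΦ M c)
    (hM : HasHighestWeightVector b M μ) :
    c = casimirValue b (cartanInvariantForm H hΦ hsymm hinv).form μ := by
  obtain ⟨v, hv0, hcartan, hpos⟩ := hM
  have hv : IsPrimitiveVector b μ v := ⟨hcartan, hpos⟩
  exact smul_left_injective ℂ hv0 ((hc v).symm.trans (hv.casimir_apply_eq_smul hΦ hsymm hinv))

theorem HasHighestWeightVector.hasCasimirEigenvalue [LieModule.IsIrreducible ℂ L M]
    (hM : HasHighestWeightVector b M μ) :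
    HasCasimirEigenvalue Φ hΦ M
      (casimirValue b (cartanInvariantForm H hΦ hsymm hinv).form μ) := by
  obtain ⟨v, hv0, hcartan, hpos⟩ := hM
  have hv : IsPrimitiveVector b μ v := ⟨hcartan, hpos⟩
  exact hasCasimirEigenvalue_of_isIrreducible hΦ hinv hv0 (hv.casimir_apply_eq_smul hΦ hsymm hinv)

end HighestWeightVectors

section HighestRoot

lemma RootLE.height_le {ι R M N : Type*} [CommRing R] [CharZero R]
    [AddCommGroup M] [Module R M] [AddCommGroup N] [Module R N] {P : RootPairing ι R M N}
    {b : P.Base} {i j : ι} (h : RootLE b i j) : b.height i ≤ b.height j := by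
  obtain ⟨f, hf⟩ : ∃ f : ι → ℕ, ∑ l ∈ b.support, f l • P.root l = P.root j - P.root i := by
    rw [RootLE, ← Submodule.span_nat_eq_addSubmonoidClosure] at h
    exact (Submodule.mem_span_image_finset_iff_exists_fun' ℕ).1 h
  obtain ⟨g, -, -, hg⟩ := b.exists_root_eq_sum_int i
  have hj : P.root j = ∑ l ∈ b.support, (g l + f l) • P.root l := by
    rw [← sub_add_cancel (P.root j) (P.root i), ← hf, hg]
    simp only [add_smul, Finset.sum_add_distrib, natCast_zsmul]
    exact add_comm _ _
  rw [b.height_eq_sum hg, b.height_eq_sum hj, Finset.sum_add_distrib]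
  exact le_add_of_nonneg_right (Finset.sum_nonneg fun l _ ↦ Int.natCast_nonneg (f l))

variable {L : Type*} [LieRing L] [LieAlgebra ℂ L] [FiniteDimensional ℂ L] [IsSimple ℂ L]
  {H : LieSubalgebra ℂ L} [H.IsCartanSubalgebra] {b : (IsKilling.rootSystem H).Base}

lemma rootSpace_add_eq_bot {α θ : H.root} (hθ : ∀ j, RootLE b j θ) (hα : b.IsPos α) :
    rootSpace H (α.1 + θ.1 : H → ℂ) = ⊥ := by
  by_contra hbot
  let χ : Weight ℂ H L := ⟨_, hbot⟩
  have hheight_le (j : H.root) : b.height j ≤ b.height θ := (hθ j).height_le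
  have hα' : 0 < b.height α := hα
  by_cases hχ : χ.IsZero
  · let _ := (IsKilling.rootSystem H).indexNeg
    have hroot : (IsKilling.rootSystem H).root θ = (IsKilling.rootSystem H).root (-α) := by
      rw [RootPairing.indexNeg_neg, RootPairing.root_reflectionPerm,
        RootPairing.reflection_apply_self]
      exact LinearMap.ext fun h ↦ eq_neg_of_add_eq_zero_right (congrFun hχ h)
    have hθα : b.height θ = -b.height α := by
      rw [(IsKilling.rootSystem H).root.injective hroot]
      exact b.height_reflectionPerm_self α
    linarith [hheight_le α]
  · let γ : H.root := ⟨χ, by simpa using hχ⟩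
    have hγ : b.height γ = b.height α + b.height θ := b.height_add rfl
    linarith [hheight_le γ]

lemma hasHighestWeightVector_self {θ : H.root} (hθ : ∀ j, RootLE b j θ) :
    HasHighestWeightVector b L ((IsKilling.rootSystem H).root θ) := by
  obtain ⟨e, he, he0⟩ := θ.1.exists_ne_zero
  refine ⟨e, he0, fun h ↦ IsKilling.lie_eq_smul_of_mem_rootSpace he h, fun α hα x hx ↦ ?_⟩
  have hmem : ⁅x, e⁆ ∈ rootSpace H (α.1 + θ.1 : H → ℂ) :=
    lie_mem_genWeightSpace_of_mem_genWeightSpace hx he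
  rwa [rootSpace_add_eq_bot hθ hα, LieSubmodule.mem_bot] at hmem

end HighestRoot

lemma two_mul_sum_fin_cast {R : Type*} [CommRing R] (k : ℕ) :
    2 * ∑ i : Fin k, (i : R) = k * (k - 1) := by
  induction k with
  | zero => simp
  | succ k ih =>
    rw [Fin.sum_univ_castSucc, mul_add]
    simp only [Fin.val_castSucc, Fin.val_last, ih]
    push_cast
    ring

end CasimirSeries

end

open CasimirSeries in
theorem mainTheorem9_general {L : Type*} [LieRing L] [LieAlgebra ℂ L] [FiniteDimensional ℂ L]
    [LieAlgebra.IsSimple ℂ L] (H : LieSubalgebra ℂ L) [H.IsCartanSubalgebra]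
    (b : (LieAlgebra.IsKilling.rootSystem H).Base)
    (Φ : LinearMap.BilinForm ℂ L) (hΦ : Φ.Nondegenerate) (hsymm : Φ.IsSymm)
    (hinv : Φ.lieInvariant L) (k : ℕ) (hk : 0 < k) (r : Fin k → H.root)
    (hfirst : ∀ j, RootLE b j (r ⟨0, hk⟩)) (hr : IsDominantOrthogonalSequence b r)
    (t β : ℂ) (ht : HasCasimirEigenvalue Φ hΦ L (2 * t))
    (hβ : ∀ h2 : 2 ≤ k, IsVogelParameter b Φ hΦ t β (r ⟨0, hk⟩) (r ⟨1, h2⟩))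
    (M : Type*) [AddCommGroup M] [Module ℂ M] [LieRingModule L M] [LieModule ℂ L M]
    [LieModule.IsIrreducible ℂ L M]
    (hM : HasHighestWeightVector b M (∑ i, (LieAlgebra.IsKilling.rootSystem H).root (r i))) :
    HasCasimirEigenvalue Φ hΦ M (2 * k * t - k * (k - 1) * β) := by
  obtain ⟨c, d, hcd⟩ := hr.exists_casimirValue_sum_root_eq (cartanInvariantForm H hΦ hsymm hinv)
  have hc : c = 2 * t := by
    have h := ht.eq_casimirValue hΦ hsymm hinv (hasHighestWeightVector_self hfirst)
    simpa using ((hcd {⟨0, hk⟩}).symm.trans (by simpa using h.symm))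
  have hd (h2 : 2 ≤ k) : d = 2 * β := by
    obtain ⟨Y₂, hY₂, hcas⟩ := hβ h2
    have h := hcas.eq_casimirValue hΦ hsymm hinv hY₂.highestWeight
    have hpair := hcd {⟨0, hk⟩, ⟨1, h2⟩}
    rw [Finset.sum_pair (by simp), Finset.sum_pair (by simp), ← h] at hpair
    push_cast at hpair
    linear_combination hpair + 2 * hc
  have hM' := hM.hasCasimirEigenvalue hΦ hsymm hinv
  rw [hcd, Finset.sum_sub_distrib, ← Finset.sum_mul] at hM'
  convert hM' using 1
  have hsum := two_mul_sum_fin_cast (R := ℂ) k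
  rw [Finset.sum_const, Finset.card_univ, Fintype.card_fin, nsmul_eq_mul, hc]
  rcases Nat.lt_or_ge k 2 with h1 | h2
  · obtain rfl : k = 1 := by lia
    simp
  · rw [hd h2]
    linear_combination β * hsum

theorem mainTheorem9 {L : Type*} [LieRing L] [LieAlgebra ℂ L] [FiniteDimensional ℂ L]
    [LieAlgebra.IsSimple ℂ L]
    (H : LieSubalgebra ℂ L) [H.IsCartanSubalgebra]
    (b : (LieAlgebra.IsKilling.rootSystem H).Base)
    (Φ : LinearMap.BilinForm ℂ L) (hΦ : Φ.Nondegenerate) (hsymm : Φ.IsSymm)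
    (hinv : Φ.lieInvariant L)
    (k : ℕ) (hk : 0 < k) (r : Fin k → H.root)
    (hr : CasimirSeries.IsHighestOrthogonalSequence b r)
    (hdom : ∀ i : Fin k, CasimirSeries.IsDominant b
      (CasimirSeries.partialSum (P := LieAlgebra.IsKilling.rootSystem H) r i))
    (t β : ℂ) (ht : CasimirSeries.HasCasimirEigenvalue Φ hΦ L (2 * t))
    (hβ : ∀ h2 : 2 ≤ k,
      CasimirSeries.IsVogelParameter b Φ hΦ t β (r ⟨0, hk⟩) (r ⟨1, h2⟩))
    (Y : LieSubmodule ℂ L (SymmetricAlgebra ℂ L))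
    (hY : CasimirSeries.IsComponent b k
      (∑ i, (LieAlgebra.IsKilling.rootSystem H).root (r i)) Y) :
    CasimirSeries.HasCasimirEigenvalue Φ hΦ Y (2 * k * t - k * (k - 1) * β) := by
  have := hY.irreducible
  exact mainTheorem9_general H b Φ hΦ hsymm hinv k hk r (hr.first ⟨0, hk⟩ rfl)
    (hr.isDominantOrthogonalSequence hdom) t β ht hβ Y hY.highestWeight
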